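/- For elements $x,y$ of a group write $[x,y]=x^{-1}y^{-1}xy$, and let $\gamma_i$ denote the terms of the lower central series, starting with $\gamma_1(F)=F$. (1) Let $G$ be a (not necessarily finite) nilpotent group of nilpotency class at most $9$ whose exponent divides $9$, and let $T$ be any central extension of $G$, that is, a group with a surjective homomorphism $T\to G$ whose kernel lies in the centre of $T$. Then the derived group $T'$ has exponent dividing $27$. (2) Let $F$ be the free group with free generators $a,b,c,d$, let $N$ be the normal closure in $F$ of $\{g^9 \mid g\in F\}\cup\{a^3,b^3,c^3,d^3,[b,a][c,d]\}$, let $R=N\gamma_{10}(F)$ and let $A=F/R$; thus $A$ is the largest quotient of $\langle a,b,c,d\mid a^3,b^3,c^3,d^3,[b,a]=[d,c]\rangle$ with exponent dividing $9$ and nilpotency class at most $9$. Then the Schur multiplier $M(A)=(R\cap F')/[R,F]$ has exponent dividing $27$. -/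

import Mathlib

/-- The commutator `[x, y] = x⁻¹ y⁻¹ x y`. -/
def rightComm {G : Type*} [Group G] (x y : G) : G := x⁻¹ * y⁻¹ * x * y

/-- The Schur multiplier `(R ∩ F') / [R, F]` of the group `F / R`, where `F` is the free group
on `α` and `R` is a normal subgroup of `F`. -/
abbrev SchurMultiplier {α : Type*} (R : Subgroup (FreeGroup α)) : Type _ :=
  ↥(R ⊓ commutator (FreeGroup α)) ⧸
    (⁅R, (⊤ : Subgroup (FreeGroup α))⁆.subgroupOf (R ⊓ commutator (FreeGroup α)))

namespace GroupA

/-- The free group of rank four. -/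
abbrev F : Type := FreeGroup (Fin 4)

/-- The first free generator. -/
def a : F := FreeGroup.of 0

/-- The second free generator. -/
def b : F := FreeGroup.of 1

/-- The third free generator. -/
def c : F := FreeGroup.of 2

/-- The fourth free generator. -/
def d : F := FreeGroup.of 3

/-- The normal closure in `F` of all ninth powers together with
`a³, b³, c³, d³` and `[b, a] [c, d]`. -/
def N : Subgroup F :=
  Subgroup.normalClosure
    (Set.range (fun g : F => g ^ 9) ∪
      {a ^ 3, b ^ 3, c ^ 3, d ^ 3, rightComm b a * rightComm c d})

instance : N.Normal := Subgroup.normalClosure_normal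

/-- The subgroup `N γ₁₀(F)`. The quotient `F / R` is the largest quotient of
`⟨a, b, c, d | a³, b³, c³, d³, [b, a] = [d, c]⟩` of exponent dividing `9` and class at most `9`.
(The term of index `9` of Mathlib's lower central series, which starts at index `0`,
is `γ₁₀`.) -/
def R : Subgroup F := N ⊔ Subgroup.lowerCentralSeries (⊤ : Subgroup F) 9

instance : R.Normal := by
  unfold R
  infer_instance

end GroupA

/-! The extension `T` has class at most 10 and its ninth powers are central, so `⁅h ^ 9, w⁆ = 1` for
all `h`, `w`. The Hall–Petrescu expansion of this commutator writes `⁅h, w⁆ ^ 9` through powers `c i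
^ (9.choose i)` of elements deep in the lower central series. Working from the bottom of the series
upwards, γ₆ and then γ₅ have exponent dividing 9, and γ₃ has exponent dividing 27. The same
expansion for `(u * v) ^ 27` reduces `T'` to single commutators.

For `⁅x, y⁆` with `x`, `y` arbitrary, two factors are not yet controlled: `c 9` in γ₁₀ with exponent
1, and `c 3` in γ₄ with exponent 84, divisible by 3 but not by 9. Here one works inside `⟨x, y⟩`. A
two-generator group of class 3 and exponent dividing 9 has trivial cubes in γ₃
(`pow_three_of_class_three`). Hence in `⟨x, y⟩` cubing maps γₙ into γₙ₊₁ for `n ≥ 4`, so γ₁₀ has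
exponent dividing 3 and γ₄ exponent dividing 9.

For the multiplier, `F / [R, F]` is a central extension of `F / R`, and `(R ∩ F') / [R, F]` lies in
its derived group. -/

open scoped commutatorElement

/-! ### Lower central series -/

/-- The `n`-th term `γₙ` of the lower central series, starting with `γ₁ = ⊤` (and `γ₀ = ⊤`). -/
def gammaTerm (G : Type*) [Group G] (n : ℕ) : Subgroup G :=
  Subgroup.lowerCentralSeries (⊤ : Subgroup G) (n - 1)

instance gammaTerm_normal (G : Type*) [Group G] (n : ℕ) : (gammaTerm G n).Normal := by
  unfold gammaTerm; infer_instance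

theorem mem_gammaTerm_one {G : Type*} [Group G] (g : G) : g ∈ gammaTerm G 1 :=
  Subgroup.mem_top g

theorem gammaTerm_antitone (G : Type*) [Group G] : Antitone (gammaTerm G) := fun _ _ h =>
  Subgroup.lowerCentralSeries_antitone _ (Nat.sub_le_sub_right h 1)

theorem gammaTerm_succ (G : Type*) [Group G] {n : ℕ} (hn : 1 ≤ n) :
    gammaTerm G (n + 1) = ⁅gammaTerm G n, (⊤ : Subgroup G)⁆ := by
  obtain ⟨k, rfl⟩ := Nat.exists_eq_add_of_le' hn
  rfl

/-- The three subgroups lemma, applied in the quotient by `N`. -/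
theorem commutator_commutator_le_of_rotate {G : Type*} [Group G] {A B C N : Subgroup G} [N.Normal]
    (h1 : ⁅⁅B, C⁆, A⁆ ≤ N) (h2 : ⁅⁅C, A⁆, B⁆ ≤ N) : ⁅⁅A, B⁆, C⁆ ≤ N := by
  have key : ∀ K : Subgroup G, K ≤ N ↔ K.map (QuotientGroup.mk' N) = ⊥ := fun K => by
    rw [Subgroup.map_eq_bot_iff, QuotientGroup.ker_mk']
  rw [key] at h1 h2 ⊢
  simp only [Subgroup.map_commutator] at h1 h2 ⊢
  exact Subgroup.commutator_commutator_eq_bot_of_rotate h1 h2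

theorem commutator_gammaTerm_le (G : Type*) [Group G] (i j : ℕ) :
    ⁅gammaTerm G i, gammaTerm G j⁆ ≤ gammaTerm G (i + j) := by
  induction j generalizing i with
  | zero => exact Subgroup.commutator_le_left _ _
  | succ j ih =>
    rcases Nat.eq_zero_or_pos i with rfl | hi
    · rw [zero_add]; exact Subgroup.commutator_le_right _ _
    rcases Nat.eq_zero_or_pos j with rfl | hj
    · rw [zero_add, gammaTerm_succ G hi]; exact le_rfl
    rw [gammaTerm_succ G hj, Subgroup.commutator_comm]
    apply commutator_commutator_le_of_rotate
    · rw [Subgroup.commutator_comm ⊤, ← gammaTerm_succ G hi]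
      refine (ih (i + 1)).trans (gammaTerm_antitone G (by omega))
    · rw [show i + (j + 1) = (i + j) + 1 by ring, gammaTerm_succ G (by omega)]
      exact Subgroup.commutator_mono (ih i) le_rfl

theorem commutator_mem_gammaTerm {G : Type*} [Group G] {i j k : ℕ} {a b : G}
    (ha : a ∈ gammaTerm G i) (hb : b ∈ gammaTerm G j) (h : k ≤ i + j) : ⁅a, b⁆ ∈ gammaTerm G k :=
  gammaTerm_antitone G h
    (commutator_gammaTerm_le G i j (Subgroup.commutator_mem_commutator ha hb))

/-- Reduces a power condition on γₙ₊₁ to its generating commutators; `hmul` is supplied each time by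
Hall–Petrescu. -/
theorem gammaTerm_succ_induction {G : Type*} [Group G] {n e : ℕ} (hn : 1 ≤ n) (N : Subgroup G)
    (hcomm : ∀ h ∈ gammaTerm G n, ∀ w : G, ⁅h, w⁆ ^ e ∈ N)
    (hmul : ∀ u ∈ gammaTerm G (n + 1), ∀ v ∈ gammaTerm G (n + 1),
      u ^ e ∈ N → v ^ e ∈ N → (u * v) ^ e ∈ N) :
    ∀ u ∈ gammaTerm G (n + 1), u ^ e ∈ N := by
  intro u hu
  have hcl : gammaTerm G (n + 1) =
      Subgroup.closure {g | ∃ h ∈ gammaTerm G n, ∃ w ∈ (⊤ : Subgroup G), ⁅h, w⁆ = g} := by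
    rw [gammaTerm_succ G hn]; rfl
  have hu' := hu
  rw [hcl] at hu'
  induction hu' using Subgroup.closure_induction with
  | mem g hg =>
    obtain ⟨h, hh, w, -, rfl⟩ := hg
    exact hcomm h hh w
  | one => rw [one_pow]; exact N.one_mem
  | mul a b ha hb iha ihb =>
    rw [← hcl] at ha hb
    exact hmul a ha b hb (iha ha) (ihb hb)
  | inv a ha iha =>
    rw [← hcl] at ha
    rw [inv_pow]
    exact N.inv_mem (iha ha)

/-! ### Polynomial sequences and the Hall–Petrescu formulas -/

/-- `f` is a polynomial sequence up to order `m`: its `i`-th iterated difference takes values in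
`γ_{p + s i}` for all `i < m`. -/
def IsPolySeq {G : Type*} [Group G] (s : ℕ) : ℕ → ℕ → (ℕ → G) → Prop
  | 0, _, _ => True
  | m + 1, p, f =>
    (∀ n, f n ∈ gammaTerm G p) ∧ IsPolySeq s m (p + s) (fun n => f (n + 1) * (f n)⁻¹)

namespace IsPolySeq

variable {G : Type*} [Group G] {s m p q : ℕ} {f g : ℕ → G}

theorem mono (h : IsPolySeq s m p f) (hq : q ≤ p) : IsPolySeq s m q f := by
  induction m generalizing p q f with
  | zero => trivial
  | succ m ih => exact ⟨fun n => gammaTerm_antitone G hq (h.1 n), ih h.2 (by omega)⟩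

theorem of_succ (h : IsPolySeq s (m + 1) p f) : IsPolySeq s m p f := by
  induction m generalizing p f with
  | zero => trivial
  | succ m ih => exact ⟨h.1, ih h.2⟩

theorem shift (h : IsPolySeq s m p f) : IsPolySeq s m p (fun n => f (n + 1)) := by
  induction m generalizing p f with
  | zero => trivial
  | succ m ih => exact ⟨fun n => h.1 _, ih h.2⟩

/-- The three closure properties need a joint induction: the difference of a product or an inverse
involves commutators, and that of a commutator involves products. Each commutator appearing has a
difference of `f` or `g` among its entries, which supplies the extra `s` in depth. -/
theorem closure_aux (s m : ℕ) :
    (∀ (p : ℕ) (f g : ℕ → G), IsPolySeq s m p f → IsPolySeq s m p g →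
      IsPolySeq s m p (fun n => f n * g n)) ∧
    (∀ (p : ℕ) (f : ℕ → G), IsPolySeq s m p f → IsPolySeq s m p (fun n => (f n)⁻¹)) ∧
    (∀ (p q : ℕ) (f g : ℕ → G), IsPolySeq s m p f → IsPolySeq s m q g →
      IsPolySeq s m (p + q) (fun n => ⁅f n, g n⁆)) := by
  induction m with
  | zero => exact ⟨fun _ _ _ _ _ => trivial, fun _ _ _ => trivial, fun _ _ _ _ _ _ => trivial⟩
  | succ m ih =>
    obtain ⟨hmul, hinv, hcomm⟩ := ih
    refine ⟨fun p f g hf hg => ⟨fun n => mul_mem (hf.1 n) (hg.1 n), ?_⟩,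
      fun p f hf => ⟨fun n => inv_mem (hf.1 n), ?_⟩,
      fun p q f g hf hg =>
        ⟨fun n => commutator_mem_gammaTerm (hf.1 n) (hg.1 n) le_rfl, ?_⟩⟩
    · have e : (fun n => f (n + 1) * g (n + 1) * (f n * g n)⁻¹) = fun n =>
          (f (n + 1) * (f n)⁻¹) * ⁅f n, g (n + 1) * (g n)⁻¹⁆ * (g (n + 1) * (g n)⁻¹) := by
        funext n; simp only [commutatorElement_def]; group
      rw [e]
      exact hmul _ _ _ (hmul _ _ _ hf.2 ((hcomm _ _ _ _ hf.of_succ hg.2).mono (by omega))) hg.2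
    · have e : (fun n => (f (n + 1))⁻¹ * ((f n)⁻¹)⁻¹) = fun n =>
          ⁅(f n)⁻¹, (f (n + 1) * (f n)⁻¹)⁻¹⁆ * (f (n + 1) * (f n)⁻¹)⁻¹ := by
        funext n; simp only [commutatorElement_def]; group
      rw [e]
      have h2 := hinv _ _ hf.2
      exact hmul _ _ _ ((hcomm _ _ _ _ (hinv _ _ hf.of_succ) h2).mono (by omega)) h2
    · have e : (fun n => ⁅f (n + 1), g (n + 1)⁆ * ⁅f n, g n⁆⁻¹) = fun n =>
          ⁅f (n + 1), g (n + 1) * (g n)⁻¹⁆ *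
            ⁅g (n + 1) * (g n)⁻¹, ⁅f (n + 1), g n⁆⁆ *
            ⁅f (n + 1) * (f n)⁻¹, ⁅f n, g n⁆⁆ *
            ⁅⁅f n, g n⁆, ⁅f (n + 1) * (f n)⁻¹, g n⁆⁆ *
            ⁅f (n + 1) * (f n)⁻¹, g n⁆ := by
        funext n; simp only [commutatorElement_def]; group
      rw [e]
      have hf1 := hf.of_succ
      have hg1 := hg.of_succ
      have hf' := hf1.shift
      have hfg := hcomm _ _ _ _ hf1 hg1
      have hFg := hcomm _ _ _ _ hf.2 hg1
      refine hmul _ _ _ (hmul _ _ _ (hmul _ _ _ (hmul _ _ _ ?_ ?_) ?_) ?_) ?_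
      · exact (hcomm _ _ _ _ hf' hg.2).mono (by omega)
      · exact (hcomm _ _ _ _ hg.2 (hcomm _ _ _ _ hf' hg1)).mono (by omega)
      · exact (hcomm _ _ _ _ hf.2 hfg).mono (by omega)
      · exact (hcomm _ _ _ _ hfg hFg).mono (by omega)
      · exact hFg.mono (by omega)

theorem mul (hf : IsPolySeq s m p f) (hg : IsPolySeq s m p g) :
    IsPolySeq s m p (fun n => f n * g n) := (closure_aux s m).1 p f g hf hg

theorem inv (hf : IsPolySeq s m p f) : IsPolySeq s m p (fun n => (f n)⁻¹) :=
  (closure_aux s m).2.1 p f hf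

theorem comm (hf : IsPolySeq s m p f) (hg : IsPolySeq s m q g) :
    IsPolySeq s m (p + q) (fun n => ⁅f n, g n⁆) := (closure_aux s m).2.2 p q f g hf hg

theorem one (s m p : ℕ) : IsPolySeq s m p (fun _ => (1 : G)) := by
  induction m generalizing p with
  | zero => trivial
  | succ m ih => exact ⟨fun _ => one_mem _, by simpa using ih (p + s)⟩

theorem const {a : G} (s m : ℕ) (ha : a ∈ gammaTerm G p) : IsPolySeq s m p (fun _ => a) := by
  cases m with
  | zero => trivial
  | succ m => exact ⟨fun _ => ha, by simpa using one s m (p + s)⟩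

theorem pow_choose {a : G} (m i : ℕ) (ha : a ∈ gammaTerm G (p + s * i)) :
    IsPolySeq s m p (fun n => a ^ n.choose i) := by
  induction i generalizing m p with
  | zero => simpa using const s m (by simpa using ha)
  | succ i ih =>
    cases m with
    | zero => trivial
    | succ m =>
      refine ⟨fun n => pow_mem (gammaTerm_antitone G (by omega) ha) _, ?_⟩
      have e : (fun n : ℕ => a ^ (n + 1).choose (i + 1) * (a ^ n.choose (i + 1))⁻¹) =
          fun n => a ^ n.choose i := by
        funext n
        rw [Nat.choose_succ_succ, pow_add, mul_inv_cancel_right]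
      rw [e]
      exact ih m (by rwa [show p + s + s * i = p + s * (i + 1) by ring])

theorem pow {a : G} (m : ℕ) (ha : a ∈ gammaTerm G s) : IsPolySeq s m 0 (fun n => a ^ n) := by
  simpa using pow_choose (p := 0) (s := s) (a := a) m 1 (by simpa using ha)

/-- The difference of `f` vanishes at one point fewer and starts `s` deeper; summing it back up from
`f 0 = 1` recovers `f`. -/
theorem mem_of_vanish {j : ℕ} (hf : IsPolySeq s (j + 1) p f) (h0 : ∀ n < j, f n = 1) (n : ℕ) :
    f n ∈ gammaTerm G (p + s * j) := by
  induction j generalizing p f n with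
  | zero => simpa using hf.1 n
  | succ j ih =>
    have hd := ih hf.2 (fun n hn => by rw [h0 n (by omega), h0 (n + 1) (by omega)]; simp)
    have e : p + s * (j + 1) = p + s + s * j := by ring
    rw [e]
    induction n with
    | zero => rw [h0 0 (by omega)]; exact one_mem _
    | succ n ihn =>
      have := mul_mem (hd n) ihn
      simpa using this

/-- Newton interpolation: the next coefficient is the value `r j` of the remainder at its first
possibly nontrivial point, and dividing by `r j ^ n.choose j` leaves the earlier zeros intact. -/
theorem taylor (hf : ∀ m, IsPolySeq s m p f) (j : ℕ) :
    ∃ (c : ℕ → G) (r : ℕ → G), (∀ i, c i ∈ gammaTerm G (p + s * i)) ∧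
      (∀ m, IsPolySeq s m p r) ∧ (∀ n < j, r n = 1) ∧
      ∀ n, f n = ((List.range j).map fun i => c i ^ n.choose i).prod * r n := by
  induction j with
  | zero => exact ⟨fun _ => 1, f, fun _ => one_mem _, hf, by simp, by simp⟩
  | succ j ih =>
    obtain ⟨c, r, hc, hr, h0, he⟩ := ih
    have hrj : r j ∈ gammaTerm G (p + s * j) := (hr _).mem_of_vanish h0 j
    refine ⟨fun i => if i = j then r j else c i, fun n => (r j ^ n.choose j)⁻¹ * r n,
      fun i => ?_, fun m => ((pow_choose m j hrj).inv).mul (hr m), fun n hn => ?_, fun n => ?_⟩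
    · by_cases h : i = j
      · simpa [h] using hrj
      · simpa [h] using hc i
    · rcases Nat.lt_succ_iff_lt_or_eq.mp hn with h | rfl
      · simp [Nat.choose_eq_zero_of_lt h, h0 n h]
      · simp
    · rw [he n, List.range_succ, List.map_append, List.prod_append]
      have : (List.range j).map (fun i => (if i = j then r j else c i) ^ n.choose i) =
          (List.range j).map fun i => c i ^ n.choose i := by
        apply List.map_congr_left
        intro i hi
        rw [if_neg (List.mem_range.mp hi).ne]
      rw [this]
      simp [mul_assoc]

end IsPolySeq

/-- The Hall–Petrescu formula for products of elements of `γₖ`, with remainder in `γ_{kj}`. -/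
theorem mul_pow_eq_prod_choose {G : Type*} [Group G] {k : ℕ} {u v : G} (hu : u ∈ gammaTerm G k)
    (hv : v ∈ gammaTerm G k) (j n : ℕ) :
    ∃ (c : ℕ → G) (r : G), (∀ i, c i ∈ gammaTerm G (k * i)) ∧ r ∈ gammaTerm G (k * (j + 2)) ∧
      (u * v) ^ n = u ^ n * v ^ n *
        (((List.range j).map fun i => c (i + 2) ^ n.choose (i + 2)).prod * r) := by
  obtain ⟨c, r, hc, hr, h0, he⟩ := IsPolySeq.taylor (s := k) (p := 0)
    (f := fun n => (u ^ n * v ^ n)⁻¹ * (u * v) ^ n)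
    (fun m => (((IsPolySeq.pow m hu).mul (IsPolySeq.pow m hv)).inv).mul
      (IsPolySeq.pow m (mul_mem hu hv))) (j + 2)
  -- The sequence is trivial at 0 and 1, which kills the first two coefficients, so the product
  -- starts at index 2.
  have c0 : c 0 = 1 := by
    have := he 0
    simpa [List.range_succ_eq_map, h0 0 (by omega), Function.comp_def] using this.symm
  have c1 : c 1 = 1 := by
    have := he 1
    simpa [List.range_succ_eq_map, h0 1 (by omega), Function.comp_def, c0,
      Nat.choose_eq_zero_of_lt] using this.symm
  refine ⟨c, r n, fun i => by simpa using hc i,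
    by simpa using (hr _).mem_of_vanish h0 n, ?_⟩
  rw [← inv_mul_eq_iff_eq_mul, he n]
  simp [List.range_succ_eq_map, Function.comp_def, c0, c1]

/-- The Hall–Petrescu formula for commutators of powers, with remainder in `γ_{kj+l}`. -/
theorem commutator_pow_eq_prod_choose {G : Type*} [Group G] {k l : ℕ} {h w : G}
    (hh : h ∈ gammaTerm G k) (hw : w ∈ gammaTerm G l) (j n : ℕ) :
    ∃ (c : ℕ → G) (r : G), (∀ i, c i ∈ gammaTerm G (l + k * i)) ∧
      r ∈ gammaTerm G (l + k * (j + 2)) ∧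
      ⁅h ^ n, w⁆ = ⁅h, w⁆ ^ n *
        (((List.range j).map fun i => c (i + 2) ^ n.choose (i + 2)).prod * r) := by
  have hhw : ⁅h, w⁆ ∈ gammaTerm G (l + k * 1) := commutator_mem_gammaTerm hh hw (by omega)
  have P1 : ∀ m, IsPolySeq k m l (fun n => (⁅h, w⁆ ^ n)⁻¹) := fun m => by
    simpa using (IsPolySeq.pow_choose m 1 hhw).inv
  have P2 : ∀ m, IsPolySeq k m l (fun n => ⁅h ^ n, w⁆) := fun m =>
    ((IsPolySeq.pow m hh).comm (IsPolySeq.const k m hw)).mono (by omega)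
  obtain ⟨c, r, hc, hr, h0, he⟩ := IsPolySeq.taylor (s := k) (p := l)
    (f := fun n => (⁅h, w⁆ ^ n)⁻¹ * ⁅h ^ n, w⁆) (fun m => (P1 m).mul (P2 m)) (j + 2)
  have c0 : c 0 = 1 := by
    have := he 0
    simpa [List.range_succ_eq_map, h0 0 (by omega), Function.comp_def] using this.symm
  have c1 : c 1 = 1 := by
    have := he 1
    simpa [-commutatorElement_inv, List.range_succ_eq_map, h0 1 (by omega), Function.comp_def, c0,
      Nat.choose_eq_zero_of_lt] using this.symm
  refine ⟨c, r n, hc, (hr _).mem_of_vanish h0 n, ?_⟩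
  rw [← inv_mul_eq_iff_eq_mul, he n]
  simp [List.range_succ_eq_map, Function.comp_def, c0, c1]

theorem pow_eq_one_of_pow_eq_one_of_dvd {M : Type*} [Monoid M] {g : M} {m n : ℕ} (h : g ^ m = 1)
    (hmn : m ∣ n) : g ^ n = 1 := by
  obtain ⟨k, rfl⟩ := hmn
  rw [pow_mul, h, one_pow]

theorem commutatorElement_eq_one_of_mem_center_left {G : Type*} [Group G] {z : G}
    (hz : z ∈ Subgroup.center G) (w : G) : ⁅z, w⁆ = 1 :=
  commutatorElement_eq_one_iff_mul_comm.mpr (Subgroup.mem_center_iff.mp hz w).symm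

/-! ### Exponents of lower central terms in class ten -/

section ClassTen

variable {T : Type*} [Group T]

theorem eq_one_of_mem_gammaTerm (hT : gammaTerm T 11 = ⊥) {n : ℕ} {g : T}
    (hg : g ∈ gammaTerm T n) (hn : 11 ≤ n) : g = 1 := by
  have := gammaTerm_antitone T hn hg
  rwa [hT, Subgroup.mem_bot] at this

theorem pow_nine_of_mem_gammaTerm_six (hT : gammaTerm T 11 = ⊥)
    (hz : ∀ g : T, g ^ 9 ∈ Subgroup.center T) : ∀ g ∈ gammaTerm T 6, g ^ 9 = 1 := by
  refine gammaTerm_succ_induction (n := 5) (by norm_num) ⊥ (fun h hh w => ?_)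
    (fun u hu v hv hu9 hv9 => ?_)
  -- No correction factor is needed: the remainder already lies in γ of index 1 + 5·2 = 11.
  · obtain ⟨c, r, hc, hr, he⟩ :=
      commutator_pow_eq_prod_choose hh (mem_gammaTerm_one w) 0 9
    rw [eq_one_of_mem_gammaTerm hT hr (by norm_num),
      commutatorElement_eq_one_of_mem_center_left (hz h)] at he
    simpa using he.symm
  · obtain ⟨c, r, hc, hr, he⟩ := mul_pow_eq_prod_choose hu hv 0 9
    rw [Subgroup.mem_bot] at *
    rw [he, eq_one_of_mem_gammaTerm hT hr (by norm_num), hu9, hv9]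
    simp

theorem pow_nine_of_mem_gammaTerm_five (hT : gammaTerm T 11 = ⊥)
    (hz : ∀ g : T, g ^ 9 ∈ Subgroup.center T) : ∀ g ∈ gammaTerm T 5, g ^ 9 = 1 := by
  have h6 : ∀ {n m : ℕ} {g : T}, g ∈ gammaTerm T n → 6 ≤ n → 9 ∣ m → g ^ m = 1 :=
    fun hg hn hm => pow_eq_one_of_pow_eq_one_of_dvd
      (pow_nine_of_mem_gammaTerm_six hT hz _ (gammaTerm_antitone T hn hg)) hm
  refine gammaTerm_succ_induction (n := 4) (by norm_num) ⊥ (fun h hh w => ?_)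
    (fun u hu v hv hu9 hv9 => ?_)
  · obtain ⟨c, r, hc, hr, he⟩ :=
      commutator_pow_eq_prod_choose hh (mem_gammaTerm_one w) 1 9
    rw [eq_one_of_mem_gammaTerm hT hr (by norm_num),
      commutatorElement_eq_one_of_mem_center_left (hz h)] at he
    have h2 := h6 (hc 2) (by norm_num) (m := Nat.choose 9 2) (by decide)
    simpa [h2] using he.symm
  · obtain ⟨c, r, hc, hr, he⟩ := mul_pow_eq_prod_choose hu hv 1 9
    have h2 := h6 (hc 2) (by norm_num) (m := Nat.choose 9 2) (by decide)
    rw [Subgroup.mem_bot] at *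
    rw [he, eq_one_of_mem_gammaTerm hT hr (by norm_num), hu9, hv9]
    simp [h2]

theorem pow_twentySeven_of_mem_gammaTerm_three (hT : gammaTerm T 11 = ⊥)
    (hz : ∀ g : T, g ^ 9 ∈ Subgroup.center T) : ∀ g ∈ gammaTerm T 3, g ^ 27 = 1 := by
  have h5 : ∀ {n m : ℕ} {g : T}, g ∈ gammaTerm T n → 5 ≤ n → 9 ∣ m → g ^ m = 1 :=
    fun hg hn hm => pow_eq_one_of_pow_eq_one_of_dvd
      (pow_nine_of_mem_gammaTerm_five hT hz _ (gammaTerm_antitone T hn hg)) hm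
  refine gammaTerm_succ_induction (n := 2) (by norm_num) ⊥ (fun h hh w => ?_)
    (fun u hu v hv hu9 hv9 => ?_)
  · obtain ⟨c, r, hc, hr, he⟩ :=
      commutator_pow_eq_prod_choose hh (mem_gammaTerm_one w) 3 9
    have h2 := h5 (hc 2) (by norm_num) (m := Nat.choose 9 2) (by decide)
    have h4 := h5 (hc 4) (by norm_num) (m := Nat.choose 9 4) (by decide)
    -- Since 84 is divisible by 3 but not by 9, this factor is only known to vanish after a further
    -- cubing, hence 27.
    have h3 := h5 (hc 3) (by norm_num) (m := Nat.choose 9 3 * 3) (by decide)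
    rw [eq_one_of_mem_gammaTerm hT hr (by norm_num),
      commutatorElement_eq_one_of_mem_center_left (hz h)] at he
    simp only [List.range_succ, List.range_zero, List.nil_append, List.map_append, List.map_cons,
      List.map_nil, List.prod_append, List.prod_cons, List.prod_nil, mul_one, zero_add, one_mul,
      Nat.reduceAdd, h2, h4] at he
    rw [Subgroup.mem_bot, show 27 = 9 * 3 from rfl, pow_mul, eq_inv_of_mul_eq_one_left he.symm,
      inv_pow, ← pow_mul, h3, inv_one]
  · obtain ⟨c, r, hc, hr, he⟩ := mul_pow_eq_prod_choose hu hv 2 27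
    have h2 := h5 (hc 2) (by norm_num) (m := Nat.choose 27 2) (by decide)
    have h3 := h5 (hc 3) (by norm_num) (m := Nat.choose 27 3) (by decide +kernel)
    rw [Subgroup.mem_bot] at *
    rw [he, eq_one_of_mem_gammaTerm hT hr (by norm_num), hu9, hv9]
    simp [List.range_succ, h2, h3]

/-- If all simple commutators have order dividing `27`, so do all elements of the derived group. -/
theorem pow_twentySeven_of_mem_gammaTerm_two (hT : gammaTerm T 11 = ⊥)
    (hz : ∀ g : T, g ^ 9 ∈ Subgroup.center T) (hcomm : ∀ x y : T, ⁅x, y⁆ ^ 27 = 1) :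
    ∀ g ∈ gammaTerm T 2, g ^ 27 = 1 := by
  have h5 : ∀ {n m : ℕ} {g : T}, g ∈ gammaTerm T n → 5 ≤ n → 9 ∣ m → g ^ m = 1 :=
    fun hg hn hm => pow_eq_one_of_pow_eq_one_of_dvd
      (pow_nine_of_mem_gammaTerm_five hT hz _ (gammaTerm_antitone T hn hg)) hm
  refine gammaTerm_succ_induction (n := 1) (by norm_num) ⊥ (fun h _ w => hcomm h w)
    (fun u hu v hv hu27 hv27 => ?_)
  obtain ⟨c, r, hc, hr, he⟩ := mul_pow_eq_prod_choose hu hv 4 27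
  -- Here 27 divides the binomial coefficient, as `c 2` in γ₄ requires; the later `c i` lie in γ₆ or
  -- deeper, where divisibility by 9 is enough.
  have h2 : c 2 ^ Nat.choose 27 2 = 1 := pow_eq_one_of_pow_eq_one_of_dvd
    (pow_twentySeven_of_mem_gammaTerm_three hT hz _
      (gammaTerm_antitone T (by norm_num) (hc 2))) (by decide)
  have h3 := h5 (hc 3) (by norm_num) (m := Nat.choose 27 3) (by decide +kernel)
  have h4 := h5 (hc 4) (by norm_num) (m := Nat.choose 27 4) (by decide +kernel)
  have h5 := h5 (hc 5) (by norm_num) (m := Nat.choose 27 5) (by decide +kernel)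
  rw [Subgroup.mem_bot] at *
  rw [he, eq_one_of_mem_gammaTerm hT hr (by norm_num), hu27, hv27]
  simp [List.range_succ, h2, h3, h4, h5]

end ClassTen

/-! ### Two-generator groups of class three -/

/-- In a group of class at most three, the product of the `n` conjugates of `y` by
`1, x, …, x ^ (n - 1)`, collected. -/
theorem collect_class_three {G : Type*} [Group G] {x y u v w : G} (hu : x⁻¹ * y * x = y * u)
    (hw : x⁻¹ * u * x = u * w) (hv : u * y = y * u * v) (hvc : v ∈ Subgroup.center G)
    (hwc : w ∈ Subgroup.center G) (n : ℕ) :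
    (y * x⁻¹) ^ n * x ^ n = y ^ n * u ^ n.choose 2 * (w * v) ^ n.choose 3 := by
  have hvc' : ∀ g, Commute v g := fun g => (Subgroup.mem_center_iff.mp hvc g).symm
  have hwc' : ∀ g, Commute w g := fun g => (Subgroup.mem_center_iff.mp hwc g).symm
  have huyn : ∀ n : ℕ, u * y ^ n = y ^ n * u * v ^ n := fun n => by
    induction n with
    | zero => simp
    | succ n ih =>
      rw [pow_succ, ← mul_assoc, ih, mul_assoc _ (v ^ n), ((hvc' y).pow_left n).eq,
        ← mul_assoc, mul_assoc (y ^ n), hv, pow_succ' v]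
      simp only [mul_assoc]
  have hyun : ∀ n : ℕ, (y * u) ^ n = y ^ n * u ^ n * v ^ n.choose 2 := fun n => by
    induction n with
    | zero => simp
    | succ n ih =>
      rw [pow_succ', ih, show (n + 1).choose 2 = n + n.choose 2 by
        rw [Nat.choose_succ_succ' n 1, Nat.choose_one_right], pow_add v, pow_succ' y, pow_succ' u]
      calc y * u * (y ^ n * u ^ n * v ^ n.choose 2)
          = y * (u * y ^ n) * (u ^ n * v ^ n.choose 2) := by simp only [mul_assoc]
        _ = y * (y ^ n * u) * (v ^ n * u ^ n) * v ^ n.choose 2 := by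
            rw [huyn]; simp only [mul_assoc]
        _ = _ := by rw [((hvc' (u ^ n)).pow_left n).eq]; simp only [mul_assoc]
  have conj_pow' : ∀ (g : G) (k : ℕ), x⁻¹ * g ^ k * x = (x⁻¹ * g * x) ^ k := fun g k => by
    have := conj_pow (i := k) (a := x⁻¹) (b := g)
    simpa using this.symm
  induction n with
  | zero => simp
  | succ n ih =>
    have hcen : (w * v) ^ n.choose 3 ∈ Subgroup.center G := pow_mem (mul_mem hwc hvc) _
    -- Conjugating by `x` and multiplying by `y` gives the next product. Collecting `(y * u) ^ n`
    -- yields `n.choose 2` new factors `v`, and `u ↦ u * w` yields as many new `w`; Pascal's rule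
    -- does the rest.
    have step : (y * x⁻¹) ^ (n + 1) * x ^ (n + 1) =
        y * (x⁻¹ * (y ^ n * u ^ n.choose 2 * (w * v) ^ n.choose 3) * x) := by
      rw [← ih, pow_succ', pow_succ]; simp only [mul_assoc]
    have split : x⁻¹ * (y ^ n * u ^ n.choose 2 * (w * v) ^ n.choose 3) * x =
        (x⁻¹ * y ^ n * x) * (x⁻¹ * u ^ n.choose 2 * x) * (w * v) ^ n.choose 3 := by
      rw [mul_assoc x⁻¹, mul_assoc _ _ x, ← Subgroup.mem_center_iff.mp hcen x]
      group
    rw [step, split, conj_pow', conj_pow', hu, hw, hyun, ((hwc' u).symm).mul_pow,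
      Nat.choose_succ_succ' n 2, Nat.choose_succ_succ' n 1, Nat.choose_one_right, pow_add u,
      pow_add (w * v), pow_succ' y, (hwc' v).mul_pow (n.choose 2)]
    have e1 := ((hvc' (u ^ n.choose 2)).pow_left (n.choose 2)).eq
    have e2 := (((hwc' v).pow_left (n.choose 2)).pow_right (n.choose 2)).eq
    calc y * (y ^ n * u ^ n * v ^ n.choose 2 * (u ^ n.choose 2 * w ^ n.choose 2) *
          (w * v) ^ n.choose 3)
        = y * y ^ n * u ^ n * (v ^ n.choose 2 * u ^ n.choose 2) * w ^ n.choose 2 *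
          (w * v) ^ n.choose 3 := by simp only [mul_assoc]
      _ = y * y ^ n * (u ^ n * u ^ n.choose 2) * (w ^ n.choose 2 * v ^ n.choose 2) *
          (w * v) ^ n.choose 3 := by rw [e1, e2]; simp only [mul_assoc]
      _ = _ := by simp only [mul_assoc]

/-- A group generated by two elements whose commutator commutes with both has class at most two. -/
theorem gammaTerm_three_eq_bot_of_commute {G : Type*} [Group G] {x y : G}
    (hgen : Subgroup.closure {x, y} = ⊤) (hx : Commute ⁅x, y⁆ x) (hy : Commute ⁅x, y⁆ y) :
    gammaTerm G 3 = ⊥ := by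
  have hu : ⁅x, y⁆ ∈ Subgroup.center G := by
    have : (⊤ : Subgroup G) ≤ Subgroup.centralizer {⁅x, y⁆} := by
      rw [← hgen, Subgroup.closure_le]
      rintro g (rfl | rfl)
      · exact Subgroup.mem_centralizer_singleton_iff.mpr hx.eq.symm
      · exact Subgroup.mem_centralizer_singleton_iff.mpr hy.eq.symm
    exact Subgroup.mem_center_iff.mpr fun g =>
      Subgroup.mem_centralizer_singleton_iff.mp (this (Subgroup.mem_top g))
  -- Modulo the centre, an element commuting with both generators commutes with everything.
  have hright : ∀ g : G, ⁅g, x⁆ ∈ Subgroup.center G → ⁅g, y⁆ ∈ Subgroup.center G →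
      ∀ h : G, ⁅g, h⁆ ∈ Subgroup.center G := by
    intro g hgx hgy h
    have hh : h ∈ Subgroup.closure {x, y} := hgen ▸ Subgroup.mem_top h
    induction hh using Subgroup.closure_induction with
    | mem a ha => rcases ha with rfl | rfl <;> assumption
    | one => simp [one_mem]
    | mul a b _ _ ha hb =>
      rw [show ⁅g, a * b⁆ = ⁅g, a⁆ * (a * ⁅g, b⁆ * a⁻¹) by simp only [commutatorElement_def]; group]
      exact mul_mem ha (Subgroup.Normal.conj_mem inferInstance _ hb a)
    | inv a _ ha =>
      rw [show ⁅g, a⁻¹⁆ = a⁻¹ * ⁅g, a⁆⁻¹ * a⁻¹⁻¹ by simp only [commutatorElement_def]; group]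
      exact Subgroup.Normal.conj_mem inferInstance _ (inv_mem ha) _
  have hleft : ∀ g h : G, ⁅g, h⁆ ∈ Subgroup.center G := fun g => hright g
    (by rw [← commutatorElement_inv]; exact inv_mem (hright x (by simp [one_mem]) hu g))
    (by
      rw [← commutatorElement_inv]
      refine inv_mem (hright y ?_ (by simp [one_mem]) g)
      rw [← commutatorElement_inv]
      exact inv_mem hu)
  rw [gammaTerm_succ G (by norm_num : 1 ≤ 2), Subgroup.commutator_top_right_eq_bot_iff_le_center,
    gammaTerm_succ G le_rfl, Subgroup.commutator_le]
  exact fun g _ h _ => hleft g h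

theorem map_gammaTerm_of_surjective {G H : Type*} [Group G] [Group H] (f : G →* H)
    (hf : Function.Surjective f) (n : ℕ) : (gammaTerm G n).map f = gammaTerm H n := by
  unfold gammaTerm
  rw [Subgroup.map_lowerCentralSeries, Subgroup.map_top_of_surjective f hf]

theorem closure_map_pair_eq_top {G H : Type*} [Group G] [Group H] (f : G →* H)
    (hf : Function.Surjective f) {x y : G} (hgen : Subgroup.closure {x, y} = ⊤) :
    Subgroup.closure {f x, f y} = ⊤ := by
  rw [← Set.image_pair, ← MonoidHom.map_closure, hgen, Subgroup.map_top_of_surjective f hf]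

theorem gammaTerm_three_le_of_mem {G : Type*} [Group G] {x y : G}
    (hgen : Subgroup.closure {x, y} = ⊤) {N : Subgroup G} [N.Normal]
    (hx : ⁅⁅x, y⁆, x⁆ ∈ N) (hy : ⁅⁅x, y⁆, y⁆ ∈ N) : gammaTerm G 3 ≤ N := by
  have hs := QuotientGroup.mk'_surjective N
  have key : ∀ g : G, g ∈ N ↔ QuotientGroup.mk' N g = 1 := fun g => by simp
  have h := gammaTerm_three_eq_bot_of_commute (closure_map_pair_eq_top _ hs hgen)
    (by rw [← commutatorElement_eq_one_iff_commute, ← map_commutatorElement,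
          ← map_commutatorElement, ← key]; exact hx)
    (by rw [← commutatorElement_eq_one_iff_commute, ← map_commutatorElement,
          ← map_commutatorElement, ← key]; exact hy)
  rw [← map_gammaTerm_of_surjective _ hs, Subgroup.map_eq_bot_iff, QuotientGroup.ker_mk'] at h
  exact h

theorem commutatorElement_inv_left_of_mem_center {G : Type*} [Group G] {a b : G}
    (h : ⁅a, b⁆ ∈ Subgroup.center G) : ⁅a⁻¹, b⁆ = ⁅a, b⁆⁻¹ := by
  have e : ⁅a⁻¹, b⁆ = a⁻¹ * ⁅a, b⁆⁻¹ * a := by simp only [commutatorElement_def]; group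
  rw [e, Subgroup.mem_center_iff.mp (inv_mem h), inv_mul_cancel_right]

theorem commutatorElement_inv_right_of_mem_center {G : Type*} [Group G] {a b : G}
    (h : ⁅a, b⁆ ∈ Subgroup.center G) : ⁅a, b⁻¹⁆ = ⁅a, b⁆⁻¹ := by
  have e : ⁅a, b⁻¹⁆ = b⁻¹ * ⁅a, b⁆⁻¹ * b := by simp only [commutatorElement_def]; group
  rw [e, Subgroup.mem_center_iff.mp (inv_mem h), inv_mul_cancel_right]

theorem commutatorElement_mul_left_of_mem_center {G : Type*} [Group G] {a b z : G}
    (h : z ∈ Subgroup.center G) : ⁅a * z, b⁆ = ⁅a, b⁆ := by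
  rw [commutatorElement_def, commutatorElement_def, mul_inv_rev, mul_assoc a z b,
    ← Subgroup.mem_center_iff.mp h b]
  group

/-- The elements of the centre whose `n`-th power is trivial. -/
def centerTorsion (G : Type*) [Group G] (n : ℕ) : Subgroup G where
  carrier := {g | g ∈ Subgroup.center G ∧ g ^ n = 1}
  one_mem' := ⟨one_mem _, one_pow n⟩
  mul_mem' := fun {a b} ha hb => ⟨mul_mem ha.1 hb.1, by
    have : Commute a b := Subgroup.mem_center_iff.mp hb.1 a
    rw [this.mul_pow, ha.2, hb.2, one_mul]⟩
  inv_mem' := fun {a} ha => ⟨inv_mem ha.1, by rw [inv_pow, ha.2, inv_one]⟩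

instance centerTorsion_normal (G : Type*) [Group G] (n : ℕ) : (centerTorsion G n).Normal :=
  ⟨fun z hz g => by
    rw [Subgroup.mem_center_iff.mp hz.1 g, mul_inv_cancel_right]
    exact hz⟩

/-- In a two-generator group of class at most three and exponent dividing nine, the cubes of the
elements of `γ₃` are trivial. -/
theorem pow_three_of_class_three {G : Type*} [Group G] {x y : G}
    (hgen : Subgroup.closure {x, y} = ⊤) (h4 : gammaTerm G 4 = ⊥) (h9 : ∀ g : G, g ^ 9 = 1) :
    ∀ g ∈ gammaTerm G 3, g ^ 3 = 1 := by
  have hcen : gammaTerm G 3 ≤ Subgroup.center G := by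
    rwa [← Subgroup.commutator_top_right_eq_bot_iff_le_center, ← gammaTerm_succ G (by norm_num)]
  have hmem : ∀ a b c : G, ⁅⁅a, b⁆, c⁆ ∈ Subgroup.center G := fun a b c =>
    hcen (commutator_mem_gammaTerm (i := 2) (j := 1)
      (commutator_mem_gammaTerm (i := 1) (j := 1) (mem_gammaTerm_one _) (mem_gammaTerm_one _)
        le_rfl) (mem_gammaTerm_one _) le_rfl)
  have hrel : ∀ x y : G, (⁅⁅x, y⁆, x⁆ * ⁅⁅x, y⁆, y⁆) ^ 3 = 1 := by
    intro x y
    -- Inverses adapt the collection formula to `⁅x, y⁆ = x * y * x⁻¹ * y⁻¹`. Since 84 ≡ 3 mod 9,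
    -- only a cube survives.
    have h := collect_class_three (x := x⁻¹) (y := y⁻¹) (u := ⁅y, x⁆) (w := ⁅⁅x, y⁆, x⁆)
      (v := ⁅⁅x, y⁆, y⁆) (by simp only [commutatorElement_def]; group)
      (by simp only [commutatorElement_def]; group)
      (by simp only [commutatorElement_def]; group) (hmem _ _ _) (hmem _ _ _) 9
    rw [h9, h9, h9, show Nat.choose 9 2 = 9 * 4 from rfl, pow_mul ⁅y, x⁆, h9,
      show Nat.choose 9 3 = 9 * 9 + 3 from rfl, pow_add, pow_mul, h9] at h
    simpa using h.symm
  have hinv : ∀ x y : G, ⁅⁅x, y⁻¹⁆, x⁆ = ⁅⁅x, y⁆, x⁆⁻¹ ∧ ⁅⁅x, y⁻¹⁆, y⁻¹⁆ = ⁅⁅x, y⁆, y⁆ := by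
    intro x y
    have e : ⁅x, y⁻¹⁆ = ⁅x, y⁆⁻¹ * ⁅⁅x, y⁆, y⁻¹⁆ := by
      simp only [commutatorElement_def]; group
    have hx := commutatorElement_inv_left_of_mem_center (hmem x y x)
    have hy := commutatorElement_inv_left_of_mem_center (hmem x y y⁻¹)
    rw [e, commutatorElement_mul_left_of_mem_center (hmem _ _ _),
      commutatorElement_mul_left_of_mem_center (hmem _ _ _), hx, hy,
      commutatorElement_inv_right_of_mem_center (hmem x y y), inv_inv]
    exact ⟨rfl, rfl⟩
  -- Replacing `y` by `y⁻¹` inverts one of the two basic commutators and fixes the other. So their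
  -- cubes are both equal and mutually inverse; the sixth power of `⁅⁅x, y⁆, y⁆` is trivial, as is
  -- its ninth, hence its cube.
  have h1 := hrel x y
  have h2 := hrel x y⁻¹
  rw [(hinv x y).1, (hinv x y).2] at h2
  have hc : Commute ⁅⁅x, y⁆, x⁆ ⁅⁅x, y⁆, y⁆ := Subgroup.mem_center_iff.mp (hmem _ _ _) _
  rw [hc.mul_pow] at h1
  rw [hc.inv_left.mul_pow, inv_pow, inv_mul_eq_one] at h2
  have hβ : ⁅⁅x, y⁆, y⁆ ^ 3 = 1 := by
    have h9' := h9 ⁅⁅x, y⁆, y⁆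
    rw [h2, ← pow_add] at h1
    rwa [show 9 = 3 + 3 + 3 from rfl, pow_add, h1, one_mul] at h9'
  have hle := gammaTerm_three_le_of_mem hgen (N := centerTorsion G 3)
    ⟨hmem _ _ _, h2.trans hβ⟩ ⟨hmem _ _ _, hβ⟩
  exact fun g hg => (hle hg).2

/-! ### Two-generator groups of class ten -/

section TwoGenerator

variable {S : Type*} [Group S] {x y : S}

theorem pow_three_mem_sup_center (hgen : Subgroup.closure {x, y} = ⊤)
    (hz : ∀ g : S, g ^ 9 ∈ Subgroup.center S) :
    ∀ g ∈ gammaTerm S 3, g ^ 3 ∈ gammaTerm S 4 ⊔ Subgroup.center S := by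
  intro g hg
  set N := gammaTerm S 4 ⊔ Subgroup.center S with hN
  have hs := QuotientGroup.mk'_surjective N
  have key : ∀ g : S, g ∈ N ↔ QuotientGroup.mk' N g = 1 := fun g => by simp
  rw [key, map_pow]
  refine pow_three_of_class_three (closure_map_pair_eq_top _ hs hgen) ?_ (fun q => ?_) _ ?_
  · rw [← map_gammaTerm_of_surjective _ hs, Subgroup.map_eq_bot_iff, QuotientGroup.ker_mk']
    exact le_sup_left
  · obtain ⟨a, rfl⟩ := hs q
    rw [← map_pow, ← key]
    exact (le_sup_right : Subgroup.center S ≤ N) (hz a)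
  · rw [← map_gammaTerm_of_surjective _ hs]
    exact Subgroup.mem_map_of_mem _ hg

/-- Modulo γₙ₊₂, `⁅a, w⁆ ^ 3` agrees with `⁅a ^ 3, w⁆`, and the commutator with `w` discards the
central factor of `a ^ 3`. -/
theorem pow_three_mem_gammaTerm_succ {n : ℕ} (hn : 1 ≤ n)
    (h : ∀ g ∈ gammaTerm S n, g ^ 3 ∈ gammaTerm S (n + 1) ⊔ Subgroup.center S) :
    ∀ g ∈ gammaTerm S (n + 1), g ^ 3 ∈ gammaTerm S (n + 2) := by
  refine gammaTerm_succ_induction hn _ (fun a ha w => ?_) (fun u hu v hv hu3 hv3 => ?_)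
  · obtain ⟨c, r, hc, hr, he⟩ :=
      commutator_pow_eq_prod_choose ha (mem_gammaTerm_one w) 0 3
    obtain ⟨b, hb, z, hzc, hbz⟩ := Subgroup.mem_sup_of_normal_right.mp (h a ha)
    rw [← hbz, commutatorElement_mul_left_of_mem_center hzc] at he
    have hbw : ⁅b, w⁆ ∈ gammaTerm S (n + 2) :=
      commutator_mem_gammaTerm hb (mem_gammaTerm_one w) (by omega)
    have hr' := gammaTerm_antitone S (show n + 2 ≤ _ by omega) hr
    rw [he] at hbw
    exact (Subgroup.mul_mem_cancel_right _ (by simpa using hr')).mp hbw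
  · obtain ⟨c, r, hc, hr, he⟩ := mul_pow_eq_prod_choose hu hv 0 3
    rw [he]
    have hr' := gammaTerm_antitone S (show n + 2 ≤ _ by omega) hr
    exact mul_mem (mul_mem hu3 hv3) (by simpa using hr')

theorem pow_three_mem_gammaTerm_of_four_le (hgen : Subgroup.closure {x, y} = ⊤)
    (hz : ∀ g : S, g ^ 9 ∈ Subgroup.center S) {n : ℕ} (hn : 4 ≤ n) :
    ∀ g ∈ gammaTerm S n, g ^ 3 ∈ gammaTerm S (n + 1) := by
  induction n, hn using Nat.le_induction with
  | base => exact pow_three_mem_gammaTerm_succ (by norm_num) (pow_three_mem_sup_center hgen hz)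
  | succ n hn ih =>
    exact pow_three_mem_gammaTerm_succ (by omega)
      fun g hg => (le_sup_left : gammaTerm S (n + 1) ≤ _) (ih g hg)

theorem pow_nine_of_mem_gammaTerm_four (hS : gammaTerm S 11 = ⊥)
    (hgen : Subgroup.closure {x, y} = ⊤) (hz : ∀ g : S, g ^ 9 ∈ Subgroup.center S) :
    ∀ g ∈ gammaTerm S 4, g ^ 9 = 1 := by
  have h5 : ∀ {n m : ℕ} {g : S}, g ∈ gammaTerm S n → 5 ≤ n → 9 ∣ m → g ^ m = 1 :=
    fun hg hn hm => pow_eq_one_of_pow_eq_one_of_dvd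
      (pow_nine_of_mem_gammaTerm_five hS hz _ (gammaTerm_antitone S hn hg)) hm
  refine gammaTerm_succ_induction (n := 3) (by norm_num) ⊥ (fun h hh w => ?_)
    (fun u hu v hv hu9 hv9 => ?_)
  · obtain ⟨c, r, hc, hr, he⟩ :=
      commutator_pow_eq_prod_choose hh (mem_gammaTerm_one w) 2 9
    have h2 := h5 (hc 2) (by norm_num) (m := Nat.choose 9 2) (by decide)
    -- As `c 3` lies in γ₁₀ and 9 does not divide 84, the two-generator bound on cubes is needed.
    have h3 : c 3 ^ Nat.choose 9 3 = 1 := by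
      refine pow_eq_one_of_pow_eq_one_of_dvd (m := 3) ?_ (by decide)
      exact eq_one_of_mem_gammaTerm hS
        (pow_three_mem_gammaTerm_of_four_le hgen hz (by norm_num) _ (hc 3)) le_rfl
    rw [eq_one_of_mem_gammaTerm hS hr (by norm_num),
      commutatorElement_eq_one_of_mem_center_left (hz h)] at he
    simpa [List.range_succ, h2, h3] using he.symm
  · obtain ⟨c, r, hc, hr, he⟩ := mul_pow_eq_prod_choose hu hv 1 9
    have h2 := h5 (hc 2) (by norm_num) (m := Nat.choose 9 2) (by decide)
    rw [Subgroup.mem_bot] at *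
    rw [he, eq_one_of_mem_gammaTerm hS hr (by norm_num), hu9, hv9]
    simp [h2]

theorem commutatorElement_pow_twentySeven_of_closure_eq_top (hS : gammaTerm S 11 = ⊥)
    (hgen : Subgroup.closure {x, y} = ⊤) (hz : ∀ g : S, g ^ 9 ∈ Subgroup.center S) :
    ⁅x, y⁆ ^ 27 = 1 := by
  have h5 : ∀ {n m : ℕ} {g : S}, g ∈ gammaTerm S n → 5 ≤ n → 9 ∣ m → g ^ m = 1 :=
    fun hg hn hm => pow_eq_one_of_pow_eq_one_of_dvd
      (pow_nine_of_mem_gammaTerm_five hS hz _ (gammaTerm_antitone S hn hg)) hm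
  -- Expanding up to index 9 puts the remainder in γ₁₁. The factors with index 2, 3, 6, 9 survive;
  -- they commute suitably, so cubing can be done factor by factor.
  obtain ⟨c, r, hc, hr, he⟩ :=
    commutator_pow_eq_prod_choose (mem_gammaTerm_one x) (mem_gammaTerm_one y) 8 9
  have h4 := h5 (hc 4) (by norm_num) (m := Nat.choose 9 4) (by decide)
  have h5' := h5 (hc 5) (by norm_num) (m := Nat.choose 9 5) (by decide)
  have h7 := h5 (hc 7) (by norm_num) (m := Nat.choose 9 7) (by decide)
  have h8 := h5 (hc 8) (by norm_num) (m := Nat.choose 9 8) (by decide)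
  have hc9 : c 9 ^ 3 = 1 := eq_one_of_mem_gammaTerm hS
    (pow_three_mem_gammaTerm_of_four_le hgen hz (by norm_num) _ (hc 9)) le_rfl
  rw [eq_one_of_mem_gammaTerm hS hr (by norm_num),
    commutatorElement_eq_one_of_mem_center_left (hz x)] at he
  simp only [List.range_succ, List.range_zero, List.nil_append, List.map_append, List.map_cons,
    List.map_nil, List.prod_append, List.prod_cons, List.prod_nil, mul_one, zero_add,
    Nat.reduceAdd, h4, h5', h7, h8, Nat.choose_self, pow_one] at he
  have hcen9 : ∀ g : S, Commute (c 9) g := fun g => commutatorElement_eq_one_iff_commute.mp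
    (eq_one_of_mem_gammaTerm hS
      (commutator_mem_gammaTerm (hc 9) (mem_gammaTerm_one g) le_rfl) (by norm_num))
  have hcen2 : ∀ g : S, Commute g (c 2 ^ Nat.choose 9 2) := fun g => by
    rw [show Nat.choose 9 2 = 9 * 4 from rfl, pow_mul]
    exact (Subgroup.mem_center_iff.mp (pow_mem (hz (c 2)) 4) g)
  have h36 : Commute (c 3) (c 6) := commutatorElement_eq_one_iff_commute.mp
    (eq_one_of_mem_gammaTerm hS (commutator_mem_gammaTerm (hc 3) (hc 6) le_rfl) (by norm_num))
  have p2 : (c 2 ^ Nat.choose 9 2) ^ 3 = 1 := by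
    rw [← pow_mul]
    exact pow_eq_one_of_pow_eq_one_of_dvd
      (pow_twentySeven_of_mem_gammaTerm_three hS hz _ (hc 2)) (by decide)
  have p3 : (c 3 ^ Nat.choose 9 3) ^ 3 = 1 := by
    rw [← pow_mul]
    exact pow_eq_one_of_pow_eq_one_of_dvd
      (pow_nine_of_mem_gammaTerm_four hS hgen hz _ (hc 3)) (by decide)
  have p6 : (c 6 ^ Nat.choose 9 6) ^ 3 = 1 := by
    rw [← pow_mul]
    exact h5 (hc 6) (by norm_num) (by decide)
  rw [show 27 = 9 * 3 from rfl, pow_mul, eq_inv_of_mul_eq_one_left he.symm, inv_pow,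
    ((hcen9 _).symm).mul_pow, mul_assoc, ((hcen2 _).symm).mul_pow, (h36.pow_pow _ _).mul_pow, p2, p3,
    p6, hc9]
  simp

end TwoGenerator

/-! ### Central extensions and the Schur multiplier -/

theorem commutatorElement_pow_twentySeven {T : Type*} [Group T] (hT : gammaTerm T 11 = ⊥)
    (hz : ∀ g : T, g ^ 9 ∈ Subgroup.center T) (x y : T) : ⁅x, y⁆ ^ 27 = 1 := by
  let S := Subgroup.closure {x, y}
  have hx : x ∈ S := Subgroup.subset_closure (by simp)
  have hy : y ∈ S := Subgroup.subset_closure (by simp)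
  have hgen : Subgroup.closure {(⟨x, hx⟩ : S), ⟨y, hy⟩} = ⊤ := by
    apply Subgroup.map_injective S.subtype_injective
    rw [MonoidHom.map_closure, Set.image_pair, ← MonoidHom.range_eq_map, Subgroup.range_subtype]
    rfl
  have hS : gammaTerm S 11 = ⊥ := by
    apply Subgroup.map_injective S.subtype_injective
    rw [Subgroup.map_bot, eq_bot_iff, ← hT]
    unfold gammaTerm
    rw [Subgroup.top_subtype_lowerCentralSeries]
    exact Subgroup.lowerCentralSeries_mono _ le_top
  have hzS : ∀ g : S, g ^ 9 ∈ Subgroup.center S := fun g => Subgroup.mem_center_iff.mpr fun h =>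
    Subtype.ext (Subgroup.mem_center_iff.mp (hz g) h)
  have h := commutatorElement_pow_twentySeven_of_closure_eq_top hS hgen hzS
  exact congrArg S.subtype h

/-- If `T / Z` has class at most nine and exponent dividing nine for a central subgroup `Z`, then
the derived group of `T` has exponent dividing `27`. -/
theorem exponent_commutator_dvd_of_central_extension {G T : Type*} [Group G] [Group T]
    (hG : gammaTerm G 10 = ⊥) (h9 : ∀ g : G, g ^ 9 = 1) (π : T →* G)
    (hker : π.ker ≤ Subgroup.center T) : Monoid.exponent (commutator T) ∣ 27 := by
  have hT : gammaTerm T 11 = ⊥ := by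
    rw [gammaTerm_succ T (by norm_num), Subgroup.commutator_top_right_eq_bot_iff_le_center]
    refine le_trans ?_ hker
    rw [← Subgroup.map_eq_bot_iff, eq_bot_iff, ← hG]
    unfold gammaTerm
    rw [Subgroup.map_lowerCentralSeries]
    exact Subgroup.lowerCentralSeries_mono _ le_top
  have hz : ∀ g : T, g ^ 9 ∈ Subgroup.center T := fun g =>
    hker (by rw [MonoidHom.mem_ker, map_pow, h9])
  refine Monoid.exponent_dvd_of_forall_pow_eq_one fun g => Subtype.ext ?_
  exact pow_twentySeven_of_mem_gammaTerm_two hT hz (commutatorElement_pow_twentySeven hT hz) g g.2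

theorem exponent_schurMultiplier_dvd {α : Type*} (R : Subgroup (FreeGroup α)) [R.Normal]
    (hR : gammaTerm (FreeGroup α) 10 ≤ R) (h9 : ∀ g : FreeGroup α, g ^ 9 ∈ R) :
    Monoid.exponent (SchurMultiplier R) ∣ 27 := by
  set K := ⁅R, (⊤ : Subgroup (FreeGroup α))⁆ with hK
  have hKR : K ≤ R := Subgroup.commutator_le_left _ _
  have hs := QuotientGroup.mk'_surjective R
  let π : FreeGroup α ⧸ K →* FreeGroup α ⧸ R :=
    QuotientGroup.lift K (QuotientGroup.mk' R) fun g hg => by simpa using hKR hg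
  have hexp : Monoid.exponent (commutator (FreeGroup α ⧸ K)) ∣ 27 := by
    refine exponent_commutator_dvd_of_central_extension (G := FreeGroup α ⧸ R) ?_ (fun q => ?_) π ?_
    · rw [← map_gammaTerm_of_surjective _ hs, Subgroup.map_eq_bot_iff, QuotientGroup.ker_mk']
      exact hR
    · obtain ⟨a, rfl⟩ := hs q
      rw [← map_pow]
      exact (QuotientGroup.eq_one_iff _).mpr (h9 a)
    · intro q hq
      obtain ⟨a, rfl⟩ := QuotientGroup.mk'_surjective K q
      have ha : a ∈ R := by simpa [π, MonoidHom.mem_ker] using hq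
      refine Subgroup.mem_center_iff.mpr fun p => ?_
      obtain ⟨b, rfl⟩ := QuotientGroup.mk'_surjective K p
      have hab : ⁅a, b⁆ ∈ K := Subgroup.commutator_mem_commutator ha (Subgroup.mem_top b)
      have : QuotientGroup.mk' K ⁅a, b⁆ = 1 := (QuotientGroup.eq_one_iff _).mpr hab
      rw [map_commutatorElement, commutatorElement_eq_one_iff_mul_comm] at this
      exact this.symm
  refine Monoid.exponent_dvd_of_forall_pow_eq_one fun q => ?_
  obtain ⟨⟨g, hg⟩, rfl⟩ := QuotientGroup.mk_surjective q
  rw [← QuotientGroup.mk_pow, QuotientGroup.eq_one_iff, Subgroup.mem_subgroupOf]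
  -- A representative in `F'` has its image in the derived group of `F / [R, F]`, where the bound on
  -- central extensions applies.
  have hmem : QuotientGroup.mk' K g ∈ commutator (FreeGroup α ⧸ K) := by
    have := Subgroup.mem_map_of_mem (QuotientGroup.mk' K) hg.2
    rw [commutator_def, Subgroup.map_commutator] at this
    exact Subgroup.commutator_mono le_top le_top this
  have h := congrArg Subtype.val
    (Monoid.exponent_dvd_iff_forall_pow_eq_one.mp hexp ⟨QuotientGroup.mk' K g, hmem⟩)
  have h' : QuotientGroup.mk' K (g ^ 27) = 1 := by rw [map_pow]; exact h
  exact (QuotientGroup.eq_one_iff _).mp h'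

theorem mainTheorem5 :
    (∀ (G : Type*) (T : Type*) [Group G] [Group T] [Group.IsNilpotent G],
      Group.nilpotencyClass G ≤ 9 → Monoid.exponent G ∣ 9 →
      ∀ π : T →* G, Function.Surjective π → π.ker ≤ Subgroup.center T →
        Monoid.exponent (commutator T) ∣ 27) ∧
    Monoid.exponent (SchurMultiplier GroupA.R) ∣ 27 := by
  refine ⟨fun G T _ _ _ hclass hexp π _ hker => ?_, ?_⟩
  · exact exponent_commutator_dvd_of_central_extension
      (Subgroup.lowerCentralSeries_eq_bot_iff_nilpotencyClass_le.mpr hclass)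
      (Monoid.exponent_dvd_iff_forall_pow_eq_one.mp hexp) π hker
  · refine exponent_schurMultiplier_dvd GroupA.R (le_sup_right) fun g => ?_
    exact (le_sup_left : GroupA.N ≤ GroupA.R)
      (Subgroup.subset_normalClosure (Or.inl ⟨g, rfl⟩))
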